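/- **Conventions.** A *saturated MSN* $(X,\mathscr A,\mathscr N)$ is a measurable space $(X,\mathscr A)$ with a $\sigma$-ideal $\mathscr N\subset\mathscr A$ such that every subset of a member of $\mathscr N$ belongs to $\mathscr N$. A set $A\in\mathscr A$ is an *$\mathscr N$-essential supremum* of $\mathscr E\subset\mathscr A$ if $E\setminus A\in\mathscr N$ for all $E\in\mathscr E$, and $A\setminus B\in\mathscr N$ for every $B\in\mathscr A$ such that $E\setminus B\in\mathscr N$ for all $E\in\mathscr E$. The saturated MSNs are the objects of a category $\mathsf{MSN_{sp}}$. Its morphisms $(X,\mathscr A,\mathscr N)\to(Y,\mathscr B,\mathscr M)$ are the equivalence classes, modulo the relation $\{f\ne f'\}\in\mathscr N$, of maps $f:X\to Y$ such that $f^{-1}(B)\in\mathscr A$ for $B\in\mathscr B$, $f^{-1}(M)\in\mathscr N$ for $M\in\mathscr M$, and such that, whenever $S$ is an $\mathscr M$-essential supremum of $\mathscr F\subset\mathscr B$, $f^{-1}(S)$ is an $\mathscr N$-essential supremum of $\{f^{-1}(F):F\in\mathscr F\}$. A saturated MSN is *ccc* if each collection of members of $\mathscr A\setminus\mathscr N$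 whose pairwise intersections belong to $\mathscr N$ is countable; it is *cccc* if it is a coproduct in $\mathsf{MSN_{sp}}$ of ccc saturated MSNs. A *cccc version* of a saturated MSN $X$ is a cccc saturated MSN $\hat X$ with a morphism $\mathbf p:\hat X\to X$ of $\mathsf{MSN_{sp}}$ such that for every cccc saturated MSN $Y$ and every morphism $\mathbf q:Y\to X$ of $\mathsf{MSN_{sp}}$ there is a unique morphism $\mathbf r:Y\to\hat X$ of $\mathsf{MSN_{sp}}$ with $\mathbf q=\mathbf p\circ\mathbf r$. For a measure $\mu$ on $(X,\mathscr A)$ put $\mathscr N_\mu=\{N\in\mathscr A:\mu(N)=0\}$; $\mu$ is *semifinite* if each $A\in\mathscr A$ with $\mu(A)=\infty$ contains some $B\in\mathscr A$ with $0<\mu(B)<\infty$. A measure space $(X,\mathscr A,\mu)$ is *decomposable* if $X$ has a partition $(X_i)_{i\in I}$ into measurable sets of finite measure such that a set $E\subset X$ belongs to $\mathscr A$ as soon as $E\cap X_i\in\mathscr A$ for all $i$, and $\mu(E)=\sum_{i\in I}\mu(E\cap X_i)$ for all $E\in\mathscr A$. **Theorem.** Let $(X,\mathscr A,\mu)$ be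 a complete semifinite measure space. The saturated MSN $(X,\mathscr A,\mathscr N_\mu)$ admits a cccc version. Let $[(\hat X,\hat{\mathscr A},\hat{\mathscr N}),\mathbf p]$ be any cccc version of it. Then there is a measure $\hat\mu$ on $\hat{\mathscr A}$, not depending on the choice of $p\in\mathbf p$, such that for every $p\in\mathbf p$, $\hat\mu$ is the unique measure on $\hat{\mathscr A}$ with $p_\#\hat\mu=\mu$ and $\mathscr N_{\hat\mu}=\hat{\mathscr N}$. Furthermore, $(\hat X,\hat{\mathscr A},\hat\mu)$ is a decomposable measure space, and the (real) Banach spaces $\mathbf L_1(X,\mathscr A,\mu)$ and $\mathbf L_1(\hat X,\hat{\mathscr A},\hat\mu)$ are isometrically isomorphic. -/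

import Mathlib

open MeasureTheory CategoryTheory

universe u

/-- A saturated measurable space with negligibles `(X, 𝒜, 𝒩)`: a measurable space together with a
σ-ideal `𝒩 ⊆ 𝒜` such that every subset of a member of `𝒩` belongs to `𝒩`. -/
structure MSN : Type (u + 1) where
  carrier : Type u
  [mspace : MeasurableSpace carrier]
  negligible : Set (Set carrier)
  measurableSet_of_mem : ∀ N ∈ negligible, MeasurableSet N
  empty_mem : ∅ ∈ negligible
  saturated : ∀ N N' : Set carrier, N ⊆ N' → N' ∈ negligible → N ∈ negligible
  iUnion_mem : ∀ N : ℕ → Set carrier, (∀ n, N n ∈ negligible) → (⋃ n, N n) ∈ negligible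

namespace MSN

instance : CoeSort MSN.{u} (Type u) := ⟨MSN.carrier⟩

instance (X : MSN.{u}) : MeasurableSpace X := X.mspace

theorem union_mem (X : MSN.{u}) {A B : Set X} (hA : A ∈ X.negligible) (hB : B ∈ X.negligible) :
    A ∪ B ∈ X.negligible := by
  have h := X.iUnion_mem (fun n => if n = 0 then A else B) (by
    intro n
    by_cases hn : n = 0 <;> simp [hn, hA, hB])
  refine X.saturated _ _ ?_ h
  rintro x (hx | hx)
  · exact Set.mem_iUnion.2 ⟨0, by simpa using hx⟩
  · exact Set.mem_iUnion.2 ⟨1, by simpa using hx⟩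

/-- `A` is an `𝒩`-essential supremum of the collection `F` (of measurable sets). -/
structure IsEssSup (X : MSN.{u}) (F : Set (Set X)) (A : Set X) : Prop where
  measurableSet : MeasurableSet A
  diff_mem : ∀ E ∈ F, E \ A ∈ X.negligible
  least : ∀ B : Set X, MeasurableSet B → (∀ E ∈ F, E \ B ∈ X.negligible) → A \ B ∈ X.negligible

/-- The countable chain condition: every almost disjointed collection of measurable
non-negligible sets is countable. -/
def IsCCC (X : MSN.{u}) : Prop :=
  ∀ F : Set (Set X), (∀ A ∈ F, MeasurableSet A ∧ A ∉ X.negligible) →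
    (∀ A ∈ F, ∀ B ∈ F, A ≠ B → A ∩ B ∈ X.negligible) → F.Countable

/-- `[(𝒜, 𝒩), (ℬ, ℳ)]`-measurable maps. -/
structure MeasMap (X Y : MSN.{u}) where
  toFun : X → Y
  measurable : ∀ B : Set Y, MeasurableSet B → MeasurableSet (toFun ⁻¹' B)
  preimage_mem : ∀ M ∈ Y.negligible, toFun ⁻¹' M ∈ X.negligible

/-- Supremum preserving maps. -/
def MeasMap.IsSupPreserving {X Y : MSN.{u}} (f : MeasMap X Y) : Prop :=
  ∀ (F : Set (Set Y)) (S : Set Y), (∀ E ∈ F, MeasurableSet E) → Y.IsEssSup F S →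
    X.IsEssSup ((fun E => f.toFun ⁻¹' E) '' F) (f.toFun ⁻¹' S)

/-- Equality almost everywhere. -/
def MeasMap.AEEq {X Y : MSN.{u}} (f g : MeasMap X Y) : Prop :=
  {x | f.toFun x ≠ g.toFun x} ∈ X.negligible

/-- Being supremum preserving only depends on the class modulo equality almost everywhere. -/
theorem MeasMap.IsSupPreserving.congr {X Y : MSN.{u}} {f g : MeasMap X Y}
    (hf : f.IsSupPreserving) (h : f.AEEq g) : g.IsSupPreserving := by
  intro F S hF hS
  have hs := hf F S hF hS
  refine ⟨g.measurable S hS.measurableSet, ?_, ?_⟩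
  · rintro _ ⟨E, hE, rfl⟩
    exact g.preimage_mem (E \ S) (hS.diff_mem E hE)
  · intro B hB hEB
    have h1 : f.toFun ⁻¹' S \ B ∈ X.negligible := by
      refine hs.least B hB ?_
      rintro _ ⟨E, hE, rfl⟩
      refine X.saturated _ _ ?_ (X.union_mem (hEB _ ⟨E, hE, rfl⟩) h)
      intro x hx
      by_cases hx' : f.toFun x = g.toFun x
      · left; exact ⟨by simpa [hx'] using hx.1, hx.2⟩
      · right; exact hx'
    refine X.saturated _ _ ?_ (X.union_mem h1 h)
    intro x hx
    by_cases hx' : f.toFun x = g.toFun x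
    · left; exact ⟨by simpa [hx'] using hx.1, hx.2⟩
    · right; exact hx'

/-- Supremum preserving `[(𝒜, 𝒩), (ℬ, ℳ)]`-measurable maps. By `MeasMap.IsSupPreserving.congr`, the
members of a class of such maps modulo equality almost everywhere are all the measurable maps
that are almost everywhere equal to one of them. -/
structure SPMap (X Y : MSN.{u}) extends MeasMap X Y where
  supPreserving : toMeasMap.IsSupPreserving

instance (X Y : MSN.{u}) : CoeFun (SPMap X Y) (fun _ => X → Y) := ⟨fun f => f.toFun⟩

instance SPMap.setoid (X Y : MSN.{u}) : Setoid (SPMap X Y) where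
  r f g := f.toMeasMap.AEEq g.toMeasMap
  iseqv :=
    { refl := fun f => by simpa [MeasMap.AEEq] using X.empty_mem
      symm := fun {f g} h => by simpa only [MeasMap.AEEq, ne_comm] using h
      trans := fun {f g k} h h' => by
        refine X.saturated _ _ ?_ (X.union_mem h h')
        intro x hx
        by_cases hx' : f x = g x
        · right
          intro hgk
          exact hx (hx'.trans hgk)
        · left; exact hx' }

/-- The identity map. -/
def SPMap.id (X : MSN.{u}) : SPMap X X where
  toFun := fun x => x
  measurable := fun _ hB => hB
  preimage_mem := fun _ hM => hM
  supPreserving := fun F S _ hS => by simpa using hS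

/-- The composition `g ∘ f`. -/
def SPMap.comp {X Y Z : MSN.{u}} (f : SPMap X Y) (g : SPMap Y Z) : SPMap X Z where
  toFun := fun x => g (f x)
  measurable := fun B hB => f.measurable _ (g.measurable B hB)
  preimage_mem := fun M hM => f.preimage_mem _ (g.preimage_mem M hM)
  supPreserving := fun F S hF hS => by
    have h := f.supPreserving _ _ (by
      rintro _ ⟨E, hE, rfl⟩
      exact g.measurable E (hF E hE)) (g.supPreserving F S hF hS)
    rw [Set.image_image] at h
    exact h

/-- The category `MSN_sp` of saturated measurable spaces with negligibles. A morphism is an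
equivalence class, modulo equality almost everywhere, of supremum preserving measurable maps. -/
instance : Category.{u} MSN.{u} where
  Hom X Y := Quotient (SPMap.setoid X Y)
  id X := Quotient.mk _ (SPMap.id X)
  comp {X Y Z} := Quotient.map₂ SPMap.comp (by
    intro f f' hf g g' hg
    refine X.saturated _ _ ?_ (X.union_mem hf (f'.preimage_mem _ hg))
    intro x hx
    by_cases hx' : f x = f' x
    · right
      intro h
      apply hx
      change g (f x) = g' (f' x)
      rw [hx']
      exact h
    · left; exact hx')
  id_comp := by rintro X Y ⟨f⟩; rfl
  comp_id := by rintro X Y ⟨f⟩; rfl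
  assoc := by rintro W X Y Z ⟨f⟩ ⟨g⟩ ⟨h⟩; rfl

/-- The morphism represented by a supremum preserving measurable map. -/
def SPMap.toHom {X Y : MSN.{u}} (f : SPMap X Y) : X ⟶ Y := Quotient.mk (SPMap.setoid X Y) f

/-- `X` is cccc: it is a coproduct, in the category `MSN_sp`, of objects which are ccc. -/
def IsCCCC (X : MSN.{u}) : Prop :=
  ∃ (J : Type u) (Z : J → MSN.{u}) (i : ∀ j, Z j ⟶ X),
    (∀ j, (Z j).IsCCC) ∧ Nonempty (Limits.IsColimit (Limits.Cofan.mk X i))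

/-- `[Xh, p]` is a cccc version of `X`: a coreflection of `X` along the inclusion into `MSN_sp` of
its full subcategory of cccc objects. -/
structure IsCCCCVersion {X Xh : MSN.{u}} (p : Xh ⟶ X) : Prop where
  isCCCC : Xh.IsCCCC
  existsUnique_lift : ∀ (Y : MSN.{u}), Y.IsCCCC → ∀ q : Y ⟶ X, ∃! r : Y ⟶ Xh, q = r ≫ p

end MSN

/-- The collection `𝒩_μ` of measurable `μ`-null sets. -/
def nullSets {X : Type u} [MeasurableSpace X] (μ : Measure X) : Set (Set X) :=
  {N | MeasurableSet N ∧ μ N = 0}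

/-- The saturated measurable space with negligibles `(X, 𝒜, 𝒩_μ)` of a complete measure space. -/
@[reducible]
def MSN.ofMeasure {X : Type u} [MeasurableSpace X] (μ : Measure X) [μ.IsComplete] : MSN.{u} where
  carrier := X
  negligible := nullSets μ
  measurableSet_of_mem := fun _ h => h.1
  empty_mem := ⟨MeasurableSet.empty, measure_empty⟩
  saturated := fun _ _ h h' =>
    have h0 := measure_mono_null h h'.2
    ⟨Measure.IsComplete.out' _ h0, h0⟩
  iUnion_mem := fun _ h =>
    ⟨MeasurableSet.iUnion fun n => (h n).1, measure_iUnion_null fun n => (h n).2⟩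

/-- Every measurable set of infinite measure has a measurable subset of positive finite
measure. -/
def IsSemifinite {X : Type u} [MeasurableSpace X] (μ : Measure X) : Prop :=
  ∀ A : Set X, MeasurableSet A → μ A = ⊤ → ∃ B, MeasurableSet B ∧ B ⊆ A ∧ 0 < μ B ∧ μ B < ⊤

/-- Decomposable (also called strictly localizable) measure spaces: there is a partition of the
space into measurable sets of finite measure that determines measurability and the measure. -/
def IsDecomposable {X : Type u} [MeasurableSpace X] (μ : Measure X) : Prop :=
  ∃ (I : Type u) (P : I → Set X),
    (∀ i, MeasurableSet (P i) ∧ μ (P i) < ⊤) ∧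
    (∀ i j, i ≠ j → Disjoint (P i) (P j)) ∧ (⋃ i, P i) = Set.univ ∧
    (∀ E : Set X, (∀ i, MeasurableSet (E ∩ P i)) → MeasurableSet E) ∧
    (∀ E : Set X, MeasurableSet E → μ E = ∑' i, μ (E ∩ P i))

/-! Semifiniteness and Zorn's lemma give a maximal almost disjointed family `A i` of sets of finite
measure. Maximality makes the whole space its essential supremum and gives μ(E) = ∑ μ(E ∩ A i). The
family may be uncountable, so its null overlaps need not be removable inside X. The disjoint union
`split` of the `A i` separates them; each summand keeps all of X as carrier and makes the complement
of `A i` negligible, so the projection to X is the identity on every summand.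

The universal property rests on countability (`exists_split_lift`, `split_lift_unique`). For Y ccc
and q : Y → X, only countably many q⁻¹(A i) are non-negligible, and they cover almost all of Y
because q preserves essential suprema. Almost every y thus selects a single index, and this gives a
lift. Two lifts of q use countably many summands each, and differ only over countably many overlaps
A i ∩ A j. A cccc Y is treated one ccc summand at a time.

On `split`, the measure is the sum of the traces of μ. It is the only candidate: the prescribed null
sets force a measure to be the sum of its restrictions to the summands, and the i-th summand is
almost everywhere the preimage of `A i` (`eq_splitMeasure`). Any other cccc version is isomorphic to
`split` over X, and everything is transported along the isomorphism. Composition with p is an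
isometry of L₁ spaces; it is onto because a set of finite measure essentially meets only countably
many summands, hence is almost everywhere a preimage. -/

namespace MSN

/-! ### Negligible sets, essential suprema and the countable chain condition -/

section Negligible

theorem biUnion_mem (X : MSN.{u}) {ι : Type*} {s : Set ι} (hs : s.Countable) {N : ι → Set X}
    (h : ∀ i ∈ s, N i ∈ X.negligible) : (⋃ i ∈ s, N i) ∈ X.negligible := by
  rcases s.eq_empty_or_nonempty with rfl | hne
  · simpa using X.empty_mem
  · obtain ⟨f, rfl⟩ := hs.exists_eq_range hne
    rw [Set.biUnion_range]
    exact X.iUnion_mem _ fun n => h _ ⟨n, rfl⟩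

/-- A set that agrees with a measurable set off a negligible set is measurable. -/
theorem measurableSet_of_agree (X : MSN.{u}) {N E E' : Set X} (hN : N ∈ X.negligible)
    (hE : MeasurableSet E) (h : ∀ x ∉ N, (x ∈ E' ↔ x ∈ E)) : MeasurableSet E' := by
  have h1 : E' = (E \ N) ∪ (E' ∩ N) := by
    ext x
    have := h x
    simp only [Set.mem_union, Set.mem_sdiff, Set.mem_inter_iff]
    tauto
  rw [h1]
  exact (hE.diff (X.measurableSet_of_mem N hN)).union
    (X.measurableSet_of_mem _ (X.saturated _ _ Set.inter_subset_right hN))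

/-- A set contained in `E` off a negligible set is negligible if `E` is. -/
theorem mem_of_subset_off (X : MSN.{u}) {N E E' : Set X} (hN : N ∈ X.negligible)
    (hE : E ∈ X.negligible) (h : ∀ x ∉ N, x ∈ E' → x ∈ E) : E' ∈ X.negligible := by
  refine X.saturated _ _ ?_ (X.union_mem hE hN)
  intro x hx
  by_cases hxN : x ∈ N
  · exact Or.inr hxN
  · exact Or.inl (h x hxN hx)

/-- An upper bound B of the traces on A becomes an upper bound B ∪ Aᶜ of the original family. -/
theorem IsEssSup.inter {X : MSN.{u}} {F : Set (Set X)} {S A : Set X} (hS : X.IsEssSup F S)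
    (hA : MeasurableSet A) : X.IsEssSup ((fun E => E ∩ A) '' F) (S ∩ A) where
  measurableSet := hS.measurableSet.inter hA
  diff_mem := by
    rintro _ ⟨E, hE, rfl⟩
    refine X.saturated _ _ ?_ (hS.diff_mem E hE)
    rintro x ⟨⟨hx, hxA⟩, hxS⟩
    exact ⟨hx, fun h => hxS ⟨h, hxA⟩⟩
  least := by
    intro B hB h
    refine X.saturated _ _ ?_ (hS.least (B ∪ Aᶜ) (hB.union hA.compl) ?_)
    · rintro x ⟨⟨hx, hxA⟩, hxB⟩
      exact ⟨hx, by simp [hxA, hxB]⟩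
    · intro E hE
      refine X.saturated _ _ ?_ (h _ ⟨E, hE, rfl⟩)
      rintro x ⟨hx, hxB⟩
      simp only [Set.mem_union, Set.mem_compl_iff, not_or, not_not] at hxB
      exact ⟨⟨hx, hxB.2⟩, hxB.1⟩

/-- In a ccc space, an almost disjointed family has only countably many non-negligible members. -/
theorem IsCCC.countable_not_mem {X : MSN.{u}} (hX : X.IsCCC) {ι : Type*} {B : ι → Set X}
    (hB : ∀ i, MeasurableSet (B i)) (hd : ∀ i j, i ≠ j → B i ∩ B j ∈ X.negligible) :
    {i | B i ∉ X.negligible}.Countable := by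
  have hc := hX (B '' {i | B i ∉ X.negligible}) (by
      rintro _ ⟨i, hi, rfl⟩
      exact ⟨hB i, hi⟩) (by
      rintro _ ⟨i, hi, rfl⟩ _ ⟨j, hj, rfl⟩ hij
      exact hd i j fun h => hij (h ▸ rfl))
  refine Set.countable_of_injective_of_countable_image ?_ hc
  intro i hi j hj hij
  by_contra hne
  have h := hd i j hne
  rw [← hij, Set.inter_self] at h
  exact hi h

/-- A measurable set that meets every member of a family with essential supremum the whole space
in a negligible set is itself negligible. -/
theorem IsEssSup.mem_of_inter_mem {X : MSN.{u}} {F : Set (Set X)} (hF : X.IsEssSup F Set.univ)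
    {C : Set X} (hC : MeasurableSet C) (h : ∀ E ∈ F, E ∩ C ∈ X.negligible) :
    C ∈ X.negligible := by
  have := hF.least Cᶜ hC.compl (fun E hE => by simpa [Set.sdiff_eq] using h E hE)
  simpa [Set.sdiff_eq] using this

/-- If the whole space is the essential supremum of a family, countably many members of which
contain all but a negligible part of every member, then these countably many members cover
almost all of the space. -/
theorem IsEssSup.compl_biUnion_mem {X : MSN.{u}} {ι : Type*} {B : ι → Set X}
    (hF : X.IsEssSup (Set.range B) Set.univ) (hB : ∀ i, MeasurableSet (B i)) {J : Set ι}
    (hJ : J.Countable) (h : ∀ i ∉ J, B i ∈ X.negligible) :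
    (⋃ i ∈ J, B i)ᶜ ∈ X.negligible := by
  refine hF.mem_of_inter_mem (MeasurableSet.biUnion hJ fun i _ => hB i).compl ?_
  rintro _ ⟨i, rfl⟩
  by_cases hi : i ∈ J
  · convert X.empty_mem
    rw [← Set.sdiff_eq, Set.sdiff_eq_empty]
    exact Set.subset_biUnion_of_mem (u := fun i => B i) hi
  · exact X.saturated _ _ Set.inter_subset_left (h i hi)

end Negligible

/-! ### Morphisms and their representatives -/

section Hom

theorem SPMap.toHom_eq_iff {X Y : MSN.{u}} {f g : SPMap X Y} :
    f.toHom = g.toHom ↔ {x | f x ≠ g x} ∈ X.negligible :=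
  ⟨fun h => Quotient.exact h, fun h => Quotient.sound h⟩

theorem exists_toHom_eq {X Y : MSN.{u}} (q : X ⟶ Y) : ∃ f : SPMap X Y, f.toHom = q :=
  Quotient.exists_rep q

end Hom

/-! ### Coproducts as disjoint unions -/

section Sigma

variable {J : Type u} (Z : J → MSN.{u})

/-- The disjoint union of a family of saturated measurable spaces with negligibles. -/
def sigma : MSN.{u} where
  carrier := Σ j, Z j
  mspace := ⨅ j, (Z j).mspace.map (Sigma.mk j)
  negligible := {E | ∀ j, Sigma.mk j ⁻¹' E ∈ (Z j).negligible}
  measurableSet_of_mem := fun N hN =>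
    MeasurableSpace.measurableSet_iInf.2 fun j => (Z j).measurableSet_of_mem _ (hN j)
  empty_mem := fun j => (Z j).empty_mem
  saturated := fun N N' h h' j => (Z j).saturated _ _ (Set.preimage_mono h) (h' j)
  iUnion_mem := fun N h j => by
    rw [Set.preimage_iUnion]
    exact (Z j).iUnion_mem _ fun n => h n j

/-- The `j`-th summand of a subset of a disjoint union. -/
def slice {Z : J → MSN.{u}} (E : Set (sigma Z)) (j : J) : Set (Z j) :=
  (fun x => (⟨j, x⟩ : Σ j, Z j)) ⁻¹' E

variable {Z}

theorem measurableSet_sigma_iff {E : Set (sigma Z)} :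
    MeasurableSet E ↔ ∀ j, MeasurableSet (slice E j) :=
  MeasurableSpace.measurableSet_iInf

/-- Given subsets of all summands, their disjoint union. -/
def unslice (B : ∀ j, Set (Z j)) : Set (sigma Z) := fun x => x.2 ∈ B x.1

theorem measurableSet_unslice {B : ∀ j, Set (Z j)} (hB : ∀ j, MeasurableSet (B j)) :
    MeasurableSet (unslice B) := measurableSet_sigma_iff.2 hB

theorem IsEssSup.slice {F : Set (Set (sigma Z))} {S : Set (sigma Z)}
    (hS : (sigma Z).IsEssSup F S) (j : J) :
    (Z j).IsEssSup ((fun E => MSN.slice E j) '' F) (MSN.slice S j) where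
  measurableSet := measurableSet_sigma_iff.1 hS.measurableSet j
  diff_mem := by
    rintro _ ⟨E, hE, rfl⟩
    exact hS.diff_mem E hE j
  least := by
    classical
    intro B hB h
    -- Filling every other summand completely makes the upper bound condition vacuous there.
    let B' : ∀ k, Set (Z k) := Function.update (fun _ => Set.univ) j B
    have hj : B' j = B := Function.update_self ..
    have hk : ∀ k, k ≠ j → B' k = Set.univ := fun k hk => Function.update_of_ne hk ..
    have := hS.least (unslice B') (measurableSet_unslice fun k => ?_) ?_ j
    · change MSN.slice S j \ B' j ∈ _ at this
      rwa [hj] at this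
    · by_cases hkj : k = j
      · subst hkj; rwa [hj]
      · rw [hk k hkj]; exact MeasurableSet.univ
    · intro E hE k
      change MSN.slice E k \ B' k ∈ _
      by_cases hkj : k = j
      · subst hkj; rw [hj]; exact h _ ⟨E, hE, rfl⟩
      · rw [hk k hkj, Set.sdiff_univ]; exact (Z k).empty_mem

theorem isEssSup_sigma {F : Set (Set (sigma Z))} {S : Set (sigma Z)}
    (h : ∀ j, (Z j).IsEssSup ((fun E => MSN.slice E j) '' F) (MSN.slice S j)) :
    (sigma Z).IsEssSup F S where
  measurableSet := measurableSet_sigma_iff.2 fun j => (h j).measurableSet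
  diff_mem := fun E hE j => (h j).diff_mem _ ⟨E, hE, rfl⟩
  least := fun B hB hEB j => (h j).least (MSN.slice B j) (measurableSet_sigma_iff.1 hB j) (by
    rintro _ ⟨E, hE, rfl⟩
    exact hEB E hE j)

/-- The inclusion of a summand into a disjoint union. -/
def sigmaIncl (Z : J → MSN.{u}) (j : J) : SPMap (Z j) (sigma Z) where
  toFun := fun x => (⟨j, x⟩ : Σ j, Z j)
  measurable := fun _ hB => measurableSet_sigma_iff.1 hB j
  preimage_mem := fun _ hM => hM j
  supPreserving := fun _ _ _ hS => hS.slice j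

/-- The map out of a disjoint union given by maps out of the summands. -/
def sigmaDesc {W : MSN.{u}} (f : ∀ j, SPMap (Z j) W) : SPMap (sigma Z) W where
  toFun := fun x => f x.1 x.2
  measurable := fun B hB => measurableSet_sigma_iff.2 fun j => (f j).measurable B hB
  preimage_mem := fun M hM j => (f j).preimage_mem M hM
  supPreserving := fun F S hF hS => isEssSup_sigma fun j => by
    rw [Set.image_image]
    exact (f j).supPreserving F S hF hS

/-- The disjoint union is a coproduct in `MSN_sp`. -/
theorem isCCCC_sigma (h : ∀ j, (Z j).IsCCC) : (sigma Z).IsCCCC := by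
  refine ⟨J, Z, fun j => (sigmaIncl Z j).toHom, h, ⟨Limits.Cofan.IsColimit.mk _
    (fun s => (sigmaDesc fun j => Quotient.out (s.inj j)).toHom) ?_ ?_⟩⟩
  · intro s j
    exact Quotient.out_eq (s.inj j)
  · intro s m hm
    obtain ⟨m, rfl⟩ := exists_toHom_eq m
    refine SPMap.toHom_eq_iff.2 fun j => ?_
    have h1 : ((sigmaIncl Z j).comp m).toHom = (Quotient.out (s.inj j)).toHom :=
      (hm j).trans (Quotient.out_eq (s.inj j)).symm
    exact SPMap.toHom_eq_iff.1 h1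

end Sigma

/-! ### Disjoint unions of traces and the universal property -/

section Split

/-- The space `X` in which all subsets of the complement of `A` are made negligible. -/
def trace (X : MSN.{u}) {A : Set X} (hA : MeasurableSet A) : MSN.{u} where
  carrier := X
  mspace :=
    { MeasurableSet' := fun E => MeasurableSet (E ∩ A)
      measurableSet_empty := by simp
      measurableSet_compl := fun E hE => by
        have : Eᶜ ∩ A = A \ (E ∩ A) := by
          ext x; simp only [Set.mem_inter_iff, Set.mem_compl_iff, Set.mem_sdiff]; tauto
        rw [this]
        exact hA.diff hE
      measurableSet_iUnion := fun E hE => by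
        rw [Set.iUnion_inter]
        exact MeasurableSet.iUnion hE }
  negligible := {E : Set X | E ∩ A ∈ X.negligible}
  measurableSet_of_mem := fun _ hN => X.measurableSet_of_mem _ hN
  empty_mem := by simpa using X.empty_mem
  saturated := fun _ _ h h' => X.saturated _ _ (Set.inter_subset_inter_left A h) h'
  iUnion_mem := fun N h => by
    change (⋃ n, N n) ∩ A ∈ X.negligible
    rw [Set.iUnion_inter]
    exact X.iUnion_mem _ h

variable {X : MSN.{u}}

/-- The identity map, from the trace of `X` on `A` to `X`. -/
def traceMap {A : Set X} (hA : MeasurableSet A) : SPMap (X.trace hA) X where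
  toFun := fun x => x
  measurable := fun _ hB => hB.inter hA
  preimage_mem := fun M hM => X.saturated (M ∩ A) M Set.inter_subset_left hM
  supPreserving := fun F S _ hS => by
    have h := hS.inter hA
    refine ⟨h.measurableSet, ?_, ?_⟩
    · rintro _ ⟨E, hE, rfl⟩
      exact X.saturated _ _ Set.inter_subset_left (hS.diff_mem E hE)
    · intro B hB hEB
      refine X.saturated _ _ ?_ (h.least (B ∩ A) hB ?_)
      · rintro x ⟨⟨hx, hxB⟩, hxA⟩
        exact ⟨⟨hx, hxA⟩, fun h => hxB h.1⟩
      · rintro _ ⟨E, hE, rfl⟩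
        refine X.saturated _ _ ?_ (hEB _ ⟨E, hE, rfl⟩)
        rintro x ⟨⟨hx, hxA⟩, hxB⟩
        exact ⟨⟨hx, fun h => hxB ⟨h, hxA⟩⟩, hxA⟩

theorem IsEssSup.of_trace {A : Set X} {hA : MeasurableSet A} {F : Set (Set X)} {S : Set X}
    (hS : (X.trace hA).IsEssSup F S) : X.IsEssSup ((fun E => E ∩ A) '' F) (S ∩ A) where
  measurableSet := hS.measurableSet
  diff_mem := by
    rintro _ ⟨E, hE, rfl⟩
    refine X.saturated _ _ ?_ (hS.diff_mem E hE)
    rintro x ⟨⟨hx, hxA⟩, hxS⟩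
    exact ⟨⟨hx, fun h => hxS ⟨h, hxA⟩⟩, hxA⟩
  least := by
    intro B hB h
    refine X.saturated _ _ ?_ (hS.least B (hB.inter hA) ?_)
    · rintro x ⟨⟨hx, hxA⟩, hxB⟩
      exact ⟨⟨hx, hxB⟩, hxA⟩
    · intro E hE
      refine X.saturated _ _ ?_ (h _ ⟨E, hE, rfl⟩)
      rintro x ⟨⟨hx, hxB⟩, hxA⟩
      exact ⟨⟨hx, hxA⟩, hxB⟩

variable {I : Type u} {A : I → Set X}

/-- The disjoint union of the traces of `X` on the members of a family of measurable sets. -/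
def split (X : MSN.{u}) {A : I → Set X} (hA : ∀ i, MeasurableSet (A i)) : MSN.{u} :=
  sigma fun i => X.trace (hA i)

/-- The canonical map of a disjoint union of traces of `X` to `X`. -/
def splitMap (hA : ∀ i, MeasurableSet (A i)) : SPMap (X.split hA) X :=
  sigmaDesc fun i => traceMap (hA i)

/-- The intersection with `A i` of the `i`-th summand of a subset of `X.split hA`. -/
def piece (hA : ∀ i, MeasurableSet (A i)) (E : Set (X.split hA)) (i : I) : Set X :=
  {x | (⟨i, x⟩ : Σ _ : I, X.carrier) ∈ E ∧ x ∈ A i}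

variable {hA : ∀ i, MeasurableSet (A i)}

theorem measurableSet_split_iff {E : Set (X.split hA)} :
    MeasurableSet E ↔ ∀ i, MeasurableSet (piece hA E i) :=
  measurableSet_sigma_iff

theorem negligible_split_iff {E : Set (X.split hA)} :
    E ∈ (X.split hA).negligible ↔ ∀ i, piece hA E i ∈ X.negligible := Iff.rfl

theorem IsEssSup.piece {F : Set (Set (X.split hA))} {S : Set (X.split hA)}
    (hS : (X.split hA).IsEssSup F S) (i : I) :
    X.IsEssSup ((fun E => MSN.piece hA E i) '' F) (MSN.piece hA S i) := by
  have h := (hS.slice i).of_trace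
  have e : (fun E => MSN.piece hA E i) '' F = _ :=
    (Set.image_image (fun E : Set X => E ∩ A i)
      (fun E : Set (X.split hA) => (MSN.slice E i : Set X)) F).symm
  rw [e]
  exact h

/-- A map to `X` together with an almost everywhere correct choice of an index, with countably many
values, gives a measurable map to `X.split hA`. -/
def splitLiftMeas (hA : ∀ i, MeasurableSet (A i)) {Y : MSN.{u}} (q : SPMap Y X) (c : Y → I)
    {J : Set I} (hJ : J.Countable) {N : Set Y} (hN : N ∈ Y.negligible)
    (hc : ∀ y ∉ N, c y ∈ J ∧ ∀ i ∈ J, (q y ∈ A i ↔ c y = i)) : MeasMap Y (X.split hA) where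
  toFun := fun y => (⟨c y, q y⟩ : Σ _ : I, X.carrier)
  measurable := by
    intro B hB
    -- Off N the preimage of B is this union, which is measurable because J is countable.
    refine Y.measurableSet_of_agree hN (E := ⋃ i ∈ J, q.toFun ⁻¹' piece hA B i)
      (MeasurableSet.biUnion hJ fun i _ => q.measurable _ (measurableSet_split_iff.1 hB i)) ?_
    intro y hy
    obtain ⟨h1, h2⟩ := hc y hy
    simp only [Set.mem_preimage, Set.mem_iUnion, exists_prop]
    constructor
    · intro h
      exact ⟨c y, h1, h, (h2 _ h1).2 rfl⟩
    · rintro ⟨i, hi, h, hA'⟩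
      obtain rfl := (h2 i hi).1 hA'
      exact h
  preimage_mem := by
    intro M hM
    refine Y.mem_of_subset_off hN (E := ⋃ i ∈ J, q.toFun ⁻¹' piece hA M i)
      (Y.biUnion_mem hJ fun i _ => q.preimage_mem _ (negligible_split_iff.1 hM i)) ?_
    intro y hy h
    obtain ⟨h1, h2⟩ := hc y hy
    exact Set.mem_biUnion h1 ⟨h, (h2 _ h1).2 rfl⟩

/-- The measurable map `splitLiftMeas` is supremum preserving. -/
def splitLift (hA : ∀ i, MeasurableSet (A i)) {Y : MSN.{u}} (q : SPMap Y X) (c : Y → I)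
    {J : Set I} (hJ : J.Countable) {N : Set Y} (hN : N ∈ Y.negligible)
    (hc : ∀ y ∉ N, c y ∈ J ∧ ∀ i ∈ J, (q y ∈ A i ↔ c y = i)) : SPMap Y (X.split hA) where
  toMeasMap := splitLiftMeas hA q c hJ hN hc
  supPreserving := by
    intro F S hF hS
    refine ⟨MeasMap.measurable _ S hS.measurableSet, ?_, ?_⟩
    · rintro _ ⟨E, hE, rfl⟩
      exact MeasMap.preimage_mem (splitLiftMeas hA q c hJ hN hc) _ (hS.diff_mem E hE)
    · intro B hB hEB
      refine Y.mem_of_subset_off hN (E := ⋃ i ∈ J, q.toFun ⁻¹' piece hA S i \ B)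
        (Y.biUnion_mem hJ fun i hi => ?_) ?_
      -- On each of the countably many pieces, the lift inherits preservation of suprema from q.
      · refine (q.supPreserving _ _ ?_ (hS.piece i)).least B hB ?_
        · rintro _ ⟨E, hE, rfl⟩
          exact measurableSet_split_iff.1 (hF E hE) i
        · rintro _ ⟨_, ⟨E, hE, rfl⟩, rfl⟩
          refine Y.mem_of_subset_off hN (hEB _ ⟨E, hE, rfl⟩) ?_
          rintro y hy ⟨⟨h, hyA⟩, hyB⟩
          obtain rfl := ((hc y hy).2 i hi).1 hyA
          exact ⟨h, hyB⟩
      · rintro y hy ⟨h, hyB⟩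
        obtain ⟨h1, h2⟩ := hc y hy
        exact Set.mem_biUnion h1 ⟨⟨h, (h2 _ h1).2 rfl⟩, hyB⟩

/-- A morphism from a ccc space to `X` lifts to `X.split hA`. -/
theorem exists_split_lift [Nonempty I] (hA : ∀ i, MeasurableSet (A i))
    (hd : ∀ i j, i ≠ j → A i ∩ A j ∈ X.negligible)
    (hs : X.IsEssSup (Set.range A) Set.univ) {Y : MSN.{u}} (hY : Y.IsCCC) (q : SPMap Y X) :
    ∃ r : SPMap Y (X.split hA), ∀ y, splitMap hA (r y) = q y := by
  classical
  have hmeas : ∀ i, MeasurableSet (q.toFun ⁻¹' A i) := fun i => q.measurable _ (hA i)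
  have hdY : ∀ i j, i ≠ j → q.toFun ⁻¹' A i ∩ q.toFun ⁻¹' A j ∈ Y.negligible :=
    fun i j hij => q.preimage_mem _ (hd i j hij)
  have hsY : Y.IsEssSup (Set.range fun i => q.toFun ⁻¹' A i) Set.univ := by
    have := q.supPreserving _ _ (by rintro _ ⟨i, rfl⟩; exact hA i) hs
    rw [← Set.range_comp] at this
    exact this
  let J : Set I := {i | q.toFun ⁻¹' A i ∉ Y.negligible}
  have hJ : J.Countable := hY.countable_not_mem hmeas hdY
  have hN1 : (⋃ i ∈ J, q.toFun ⁻¹' A i)ᶜ ∈ Y.negligible :=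
    hsY.compl_biUnion_mem hmeas hJ fun i hi => not_not.1 hi
  have hN2 : (⋃ i ∈ J, ⋃ j ∈ J \ {i}, q.toFun ⁻¹' A i ∩ q.toFun ⁻¹' A j) ∈ Y.negligible :=
    Y.biUnion_mem hJ fun i _ => Y.biUnion_mem (hJ.mono Set.sdiff_subset) fun j hj =>
      hdY i j fun h => hj.2 h.symm
  -- The arbitrary value occurs only on the negligible set of `hN1`; off the overlaps of `hN2` the
  -- chosen index is the only one in J.
  let c : Y → I := fun y => if h : ∃ i, i ∈ J ∧ q y ∈ A i then h.choose else Classical.arbitrary I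
  refine ⟨splitLift hA q c hJ (Y.union_mem hN1 hN2) ?_, fun y => rfl⟩
  intro y hy
  have h : ∃ i, i ∈ J ∧ q y ∈ A i := by
    by_contra h
    exact hy (Or.inl fun h' => h (by simpa using h'))
  have h' : ∀ i ∈ J, ∀ j ∈ J \ {i}, q y ∈ A i → q y ∉ A j := fun i hi j hj hqi hqj =>
    hy (Or.inr (Set.mem_biUnion hi (Set.mem_biUnion hj ⟨hqi, hqj⟩)))
  have hc : c y = h.choose := dif_pos h
  have hc1 : c y ∈ J := hc ▸ h.choose_spec.1
  have hc2 : q y ∈ A (c y) := hc ▸ h.choose_spec.2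
  refine ⟨hc1, fun i hi => ⟨fun hq => ?_, fun hi => hi ▸ hc2⟩⟩
  by_contra hne
  exact h' i hi (c y) ⟨hc1, hne⟩ hq hc2

/-- The `i`-th summand of `X.split hA`. -/
def summand (hA : ∀ i, MeasurableSet (A i)) (i : I) : Set (X.split hA) := fun x => x.1 = i

theorem measurableSet_summand (i : I) : MeasurableSet (summand hA i) := by
  refine measurableSet_split_iff.2 fun j => ?_
  by_cases h : j = i
  · convert hA j using 1
    ext x
    exact ⟨fun hx => hx.2, fun hx => ⟨h, hx⟩⟩
  · convert MeasurableSet.empty using 1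
    ext x
    exact ⟨fun hx => h hx.1, fun hx => hx.elim⟩

/-- Suprema are tested summand by summand. A map from a ccc space preserves this supremum, so it
takes almost all its values in countably many summands. -/
theorem isEssSup_summand : (X.split hA).IsEssSup (Set.range (summand hA)) Set.univ where
  measurableSet := MeasurableSet.univ
  diff_mem := fun E _ => by simpa using (X.split hA).empty_mem
  least := fun B _ h i => by
    refine (X.trace (hA i)).saturated _ _ ?_ (h _ ⟨i, rfl⟩ i)
    rintro x ⟨-, hx⟩
    exact ⟨rfl, hx⟩

/-- Off their parts in the corresponding `A i`, the summands are negligible. -/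
theorem outside_mem : {x : X.split hA | splitMap hA x ∉ A x.1} ∈ (X.split hA).negligible := by
  refine negligible_split_iff.2 fun i => ?_
  convert X.empty_mem
  ext x
  exact ⟨fun h => h.1 h.2, fun h => h.elim⟩

/-- Morphisms from a ccc space to `X.split hA` are determined by the induced morphisms to `X`. -/
theorem split_lift_unique (hd : ∀ i j, i ≠ j → A i ∩ A j ∈ X.negligible)
    {Y : MSN.{u}} (hY : Y.IsCCC) (r r' : SPMap Y (X.split hA))
    (h : {y | splitMap hA (r y) ≠ splitMap hA (r' y)} ∈ Y.negligible) :
    {y | r y ≠ r' y} ∈ Y.negligible := by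
  have hcover : ∀ r : SPMap Y (X.split hA), ∃ J : Set I, J.Countable ∧
      (⋃ i ∈ J, r.toFun ⁻¹' summand hA i)ᶜ ∈ Y.negligible := by
    intro r
    have hm : ∀ i, MeasurableSet (r.toFun ⁻¹' summand hA i) :=
      fun i => r.measurable _ (measurableSet_summand i)
    have hs := r.supPreserving _ _ (by rintro _ ⟨i, rfl⟩; exact measurableSet_summand i)
      isEssSup_summand
    rw [← Set.range_comp] at hs
    have hJ := hY.countable_not_mem hm fun i j hij => by
      convert Y.empty_mem
      ext y
      exact ⟨fun hy => hij (hy.1.symm.trans hy.2), fun hy => hy.elim⟩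
    exact ⟨_, hJ, hs.compl_biUnion_mem hm hJ fun i hi => not_not.1 hi⟩
  obtain ⟨J, hJ, hN⟩ := hcover r
  obtain ⟨J', hJ', hN'⟩ := hcover r'
  have hO := r.preimage_mem _ (outside_mem (hA := hA))
  have hO' := r'.preimage_mem _ (outside_mem (hA := hA))
  -- Where r and r' have the same projection but distinct indices i and j, that projection lies in A
  -- i ∩ A j.
  have hK : (⋃ i ∈ J, ⋃ j ∈ J' \ {i}, {y | splitMap hA (r y) ∈ A i ∩ A j}) ∈ Y.negligible :=
    Y.biUnion_mem hJ fun i _ => Y.biUnion_mem (hJ'.mono Set.sdiff_subset) fun j hj =>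
      (r.comp (splitMap hA)).preimage_mem _ (hd i j fun h => hj.2 h.symm)
  refine Y.mem_of_subset_off (Y.union_mem (Y.union_mem hN hN') (Y.union_mem (Y.union_mem hO hO') h))
    hK ?_
  intro y hy hne
  simp only [Set.mem_union, not_or, Set.mem_compl_iff, not_not, Set.mem_iUnion, exists_prop,
    Set.mem_preimage, Set.mem_ofPred_eq, ne_eq] at hy
  obtain ⟨⟨⟨i, hi, hri⟩, ⟨j, hj, hrj⟩⟩, ⟨h1, h2⟩, h3⟩ := hy
  simp only [Set.mem_iUnion, exists_prop, Set.mem_sdiff, Set.mem_singleton_iff, Set.mem_ofPred_eq]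
  have hri' : (r y).1 = i := hri
  have hrj' : (r' y).1 = j := hrj
  refine ⟨i, hi, j, ⟨hj, ?_⟩, ?_, ?_⟩
  · intro hji
    refine hne (Sigma.ext (hri'.trans (hji.symm.trans hrj'.symm)) (heq_of_eq h3))
  · exact hri' ▸ h1
  · rw [h3]; exact hrj' ▸ h2

/-- If `X` is the essential supremum of an almost disjointed family of sets with ccc traces, then
the disjoint union of these traces is a cccc version of `X`. -/
theorem isCCCCVersion_split [Nonempty I] (hA : ∀ i, MeasurableSet (A i))
    (hd : ∀ i j, i ≠ j → A i ∩ A j ∈ X.negligible)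
    (hs : X.IsEssSup (Set.range A) Set.univ) (hccc : ∀ i, (X.trace (hA i)).IsCCC) :
    IsCCCCVersion (splitMap hA).toHom where
  isCCCC := isCCCC_sigma hccc
  existsUnique_lift := by
    have key : ∀ Y : MSN.{u}, Y.IsCCC → ∀ q : Y ⟶ X,
        ∃! r : Y ⟶ X.split hA, q = r ≫ (splitMap hA).toHom := by
      intro Y hY q
      obtain ⟨q, rfl⟩ := exists_toHom_eq q
      obtain ⟨r, hr⟩ := exists_split_lift hA hd hs hY q
      refine ⟨r.toHom, ?_, ?_⟩
      · refine SPMap.toHom_eq_iff.2 ?_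
        convert Y.empty_mem
        ext y
        exact ⟨fun h => h (hr y).symm, fun h => h.elim⟩
      · intro r' hr'
        obtain ⟨r', rfl⟩ := exists_toHom_eq r'
        refine SPMap.toHom_eq_iff.2 (split_lift_unique hd hY r' r ?_)
        refine Y.saturated _ _ ?_ (SPMap.toHom_eq_iff.1 hr')
        intro y hy h
        exact hy (h.symm.trans (hr y).symm)
    rintro Y ⟨J, Z, i, hZ, ⟨hcolim⟩⟩ q
    -- The lifts on the ccc summands glue, and glue uniquely, by the universal property of the
    -- coproduct.
    choose r hr hru using fun j => key (Z j) (hZ j) (i j ≫ q)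
    refine ⟨hcolim.desc (Limits.Cofan.mk _ r), ?_, ?_⟩
    · refine hcolim.hom_ext fun ⟨j⟩ => ?_
      have h := hcolim.fac (Limits.Cofan.mk _ r) ⟨j⟩
      rw [← Category.assoc, h]
      exact hr j
    · intro r' hr'
      refine hcolim.hom_ext fun ⟨j⟩ => ?_
      rw [hcolim.fac]
      exact hru j _ (by rw [hr']; exact (Category.assoc _ _ _).symm)

end Split
end MSN

/-! ### Maximal almost disjointed families, and surjectivity on L₁ -/

section General

variable {X : Type*} [MeasurableSpace X]

/-- A measure is the sum of its traces on an almost disjointed family that is maximal in the sense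
that sets which meet all its members in null sets are null. -/
theorem measure_eq_tsum_inter (ν : Measure X) {I : Type*} {B : I → Set X}
    (hB : ∀ i, MeasurableSet (B i)) (hd : ∀ i j, i ≠ j → ν (B i ∩ B j) = 0)
    (hmax : ∀ C, MeasurableSet C → (∀ i, ν (B i ∩ C) = 0) → ν C = 0)
    {E : Set X} (hE : MeasurableSet E) : ν E = ∑' i, ν (E ∩ B i) := by
  apply le_antisymm
  · by_cases htop : ∑' i, ν (E ∩ B i) = ⊤
    · rw [htop]; exact le_top
    -- A finite sum has countable support; what remains of E outside these members is null by
    -- maximality.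
    have hJ := Summable.countable_support_ennreal htop
    set J := Function.support fun i => ν (E ∩ B i)
    have hC : ν (E \ ⋃ i ∈ J, B i) = 0 := by
      refine hmax _ (hE.diff (MeasurableSet.biUnion hJ fun i _ => hB i)) fun i => ?_
      by_cases hi : i ∈ J
      · convert measure_empty (μ := ν)
        ext x
        refine ⟨fun hx => hx.2.2 (Set.mem_biUnion hi hx.1), fun hx => hx.elim⟩
      · refine measure_mono_null ?_ (Function.notMem_support.1 hi)
        exact fun x hx => ⟨hx.2.1, hx.1⟩
    calc ν E ≤ ν ((E \ ⋃ i ∈ J, B i) ∪ ⋃ i ∈ J, E ∩ B i) := by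
          refine measure_mono fun x hx => ?_
          by_cases h : x ∈ ⋃ i ∈ J, B i
          · right
            rw [← Set.inter_iUnion₂]
            exact ⟨hx, h⟩
          · exact Or.inl ⟨hx, h⟩
      _ ≤ 0 + ∑' i : J, ν (E ∩ B i) :=
          (measure_union_le _ _).trans (add_le_add hC.le (measure_biUnion_le ν hJ _))
      _ ≤ ∑' i, ν (E ∩ B i) := by
          rw [zero_add]
          exact ENNReal.tsum_comp_le_tsum_of_injective Subtype.val_injective _
  · refine (tsum_meas_le_meas_iUnion_of_disjoint₀ ν
      (fun i => (hE.inter (hB i)).nullMeasurableSet) ?_).trans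
      (measure_mono (Set.iUnion_subset fun i => Set.inter_subset_left))
    intro i j hij
    exact measure_mono_null (Set.inter_subset_inter Set.inter_subset_right Set.inter_subset_right)
      (hd i j hij)

/-- In a semifinite measure space there is a maximal almost disjointed family of sets of finite
measure. -/
theorem IsSemifinite.exists_maximal_family {X : Type u} [MeasurableSpace X] {μ : Measure X}
    (hμ : IsSemifinite μ) : ∃ F : Set (Set X), F.Nonempty ∧
      (∀ A ∈ F, MeasurableSet A ∧ μ A < ⊤) ∧ (∀ A ∈ F, ∀ B ∈ F, A ≠ B → μ (A ∩ B) = 0) ∧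
      ∀ C, MeasurableSet C → (∀ A ∈ F, μ (A ∩ C) = 0) → μ C = 0 := by
  obtain ⟨F, hF0, hF⟩ := zorn_subset_nonempty
    {F : Set (Set X) | (∀ A ∈ F, MeasurableSet A ∧ μ A < ⊤) ∧
      ∀ A ∈ F, ∀ B ∈ F, A ≠ B → μ (A ∩ B) = 0}
    (fun c hc hchain _ => by
      refine ⟨⋃₀ c, ⟨?_, ?_⟩, fun s hs => Set.subset_sUnion_of_mem hs⟩
      · rintro A ⟨F, hF, hA⟩
        exact (hc hF).1 A hA
      · rintro A ⟨F, hF, hA⟩ B ⟨G, hG, hB⟩ hAB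
        rcases hchain.total hF hG with h | h
        · exact (hc hG).2 A (h hA) B hB hAB
        · exact (hc hF).2 A hA B (h hB) hAB)
    -- Starting from {∅} keeps the family nonempty, so that an index always exists.
    {∅} ⟨by rintro _ rfl; simp, by rintro _ rfl _ rfl; simp⟩
  obtain ⟨h1, h2⟩ := hF.prop
  refine ⟨F, ⟨∅, hF0 rfl⟩, h1, h2, ?_⟩
  have hfin : ∀ C, MeasurableSet C → μ C < ⊤ → (∀ A ∈ F, μ (A ∩ C) = 0) → μ C = 0 := by
    intro C hC hfin h
    -- C can be adjoined to F, so it already belongs to F by maximality; taking A = C in `h` gives μ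
    -- C = 0.
    have hmem : C ∈ F := by
      refine hF.le_of_ge (y := insert C F) ⟨?_, ?_⟩ (Set.subset_insert _ _) (Set.mem_insert _ _)
      · rintro A (rfl | hA)
        · exact ⟨hC, hfin⟩
        · exact h1 A hA
      · rintro A (rfl | hA) B (rfl | hB) hAB
        · exact (hAB rfl).elim
        · rw [Set.inter_comm]; exact h B hB
        · exact h A hA
        · exact h2 A hA B hB hAB
    simpa using h C hmem
  intro C hC h
  by_cases htop : μ C = ⊤
  · obtain ⟨B, hB, hBC, hpos, hlt⟩ := hμ C hC htop
    refine (hpos.ne' (hfin B hB hlt fun A hA => ?_)).elim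
    exact measure_mono_null (Set.inter_subset_inter_right A hBC) (h A hA)
  · exact hfin C hC (lt_top_iff_ne_top.2 htop) h

/-- A measure preserving map that induces a surjection of the measure algebras of sets of finite
measure induces an isometric isomorphism of spaces of integrable functions. -/
theorem nonempty_Lp_equiv {Y : Type*} [MeasurableSpace Y] {μ : Measure X} {ν : Measure Y}
    {f : Y → X} (hf : MeasurePreserving f ν μ)
    (hsurj : ∀ E, MeasurableSet E → ν E < ⊤ → ∃ B, MeasurableSet B ∧ E =ᵐ[ν] f ⁻¹' B) :
    Nonempty (Lp ℝ 1 μ ≃ₗᵢ[ℝ] Lp ℝ 1 ν) := by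
  let T : Lp ℝ 1 μ →ₗᵢ[ℝ] Lp ℝ 1 ν := Lp.compMeasurePreservingₗᵢ ℝ f hf
  refine ⟨LinearIsometryEquiv.ofSurjective T ?_⟩
  -- The range is complete, hence closed, so it suffices that it contains the indicators of sets of
  -- finite measure.
  have hclosed : IsClosed (Set.range T) := T.isometry.isClosedEmbedding.isClosed_range
  intro g
  change g ∈ LinearMap.range T.toLinearMap
  refine Lp.induction ENNReal.one_ne_top (motive := fun g => g ∈ LinearMap.range T.toLinearMap)
    ?_ ?_ ?_ g
  · intro c E hE hEfin
    obtain ⟨B, hB, hEB⟩ := hsurj E hE hEfin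
    have hBfin : μ B ≠ ⊤ := by
      rw [← hf.measure_preimage hB.nullMeasurableSet, ← measure_congr hEB]
      exact hEfin.ne
    refine ⟨indicatorConstLp 1 hB hBfin c, ?_⟩
    rw [Lp.simpleFunc.coe_indicatorConst]
    change Lp.compMeasurePreserving f hf (indicatorConstLp 1 hB hBfin c) = _
    rw [Lp.indicatorConstLp_compMeasurePreserving]
    refine Lp.ext ?_
    refine indicatorConstLp_coeFn.trans (Filter.EventuallyEq.trans ?_ indicatorConstLp_coeFn.symm)
    exact indicator_ae_eq_of_ae_eq_set hEB.symm
  · intro f g hf hg _ h1 h2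
    exact Submodule.add_mem _ h1 h2
  · exact hclosed

end General

namespace MSN

/-! ### Transport along isomorphisms of `MSN_sp` -/

section Iso

variable {X Y : MSN.{u}}

theorem measure_eq_zero {ν : Measure X} (hν : nullSets ν = X.negligible) {N : Set X}
    (hN : N ∈ X.negligible) : ν N = 0 := (hν ▸ hN : N ∈ nullSets ν).2

theorem SPMap.measurable' (f : SPMap X Y) : Measurable f := fun B hB => f.measurable B hB

/-- The almost everywhere right inverse g turns negligibility of f⁻¹(N) back into negligibility of
N. -/
theorem nullSets_map (f : SPMap X Y) (g : SPMap Y X) (hfg : {y | f (g y) ≠ y} ∈ Y.negligible)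
    {ν : Measure X} (hν : nullSets ν = X.negligible) :
    nullSets (Measure.map f ν) = Y.negligible := by
  ext N
  constructor
  · rintro ⟨hN, h0⟩
    rw [Measure.map_apply f.measurable' hN] at h0
    have h1 : f.toFun ⁻¹' N ∈ X.negligible := hν ▸ ⟨f.measurable N hN, h0⟩
    refine Y.mem_of_subset_off hfg (g.preimage_mem _ h1) fun y hy hyN => ?_
    have hy' : f (g y) = y := not_not.1 hy
    change f (g y) ∈ N
    rwa [hy']
  · intro hN
    refine ⟨Y.measurableSet_of_mem N hN, ?_⟩
    rw [Measure.map_apply f.measurable' (Y.measurableSet_of_mem N hN)]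
    exact measure_eq_zero hν (f.preimage_mem N hN)

theorem map_congr {Z : Type*} [MeasurableSpace Z] {ν : Measure X}
    (hν : nullSets ν = X.negligible) {f g : X → Z} (h : {x | f x ≠ g x} ∈ X.negligible) :
    Measure.map f ν = Measure.map g ν :=
  Measure.map_congr (measure_eq_zero hν h)

/-- Decomposability is invariant under isomorphisms of `MSN_sp`. -/
theorem isDecomposable_map (f : SPMap X Y) (g : SPMap Y X)
    (hfg : {y | f (g y) ≠ y} ∈ Y.negligible) (hgf : {x | g (f x) ≠ x} ∈ X.negligible)
    {ν : Measure X} (hν : nullSets ν = X.negligible) (hdec : IsDecomposable ν) :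
    IsDecomposable (Measure.map f ν) := by
  obtain ⟨I, P, hP, hdisj, hcov, hmeas, hsum⟩ := hdec
  have hae : ∀ (E : Set Y) i, {x | ¬ (f x ∈ E ∩ g.toFun ⁻¹' P i ↔ f x ∈ E ∧ x ∈ P i)} ∈
      X.negligible := by
    intro E i
    refine X.saturated _ _ ?_ hgf
    intro x hx h
    apply hx
    change f x ∈ E ∧ g (f x) ∈ P i ↔ _
    rw [h]
  have hmap : ∀ (E : Set Y) i, MeasurableSet (E ∩ g.toFun ⁻¹' P i) →
      Measure.map f ν (E ∩ g.toFun ⁻¹' P i) = ν (f.toFun ⁻¹' E ∩ P i) := by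
    intro E i hE
    rw [Measure.map_apply f.measurable' hE]
    refine measure_congr (Filter.eventuallyEq_set.2 ?_)
    exact measure_eq_zero hν (hae E i)
  -- Preimages under g form an exact partition, although f and g are inverse only almost everywhere.
  refine ⟨I, fun i => g.toFun ⁻¹' P i, fun i => ⟨g.measurable _ (hP i).1, ?_⟩, ?_, ?_, ?_, ?_⟩
  · have h := hmap Set.univ i (by simpa using g.measurable _ (hP i).1)
    rw [Set.univ_inter, Set.preimage_univ, Set.univ_inter] at h
    rw [h]
    exact (hP i).2
  · exact fun i j hij => (hdisj i j hij).preimage _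
  · rw [← Set.preimage_iUnion, hcov, Set.preimage_univ]
  · intro E hE
    have h1 : MeasurableSet (f.toFun ⁻¹' E) := by
      refine hmeas _ fun i => X.measurableSet_of_agree (hae E i) (f.measurable _ (hE i)) ?_
      intro x hx
      exact (not_not.1 hx).symm
    refine Y.measurableSet_of_agree hfg (g.measurable _ h1) fun y hy => ?_
    have hy' : f (g y) = y := not_not.1 hy
    change _ ↔ f (g y) ∈ E
    rw [hy']
  · intro E hE
    rw [Measure.map_apply f.measurable' hE, hsum _ (f.measurable E hE)]
    exact tsum_congr fun i => (hmap E i (hE.inter (g.measurable _ (hP i).1))).symm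

/-- Two cccc versions of the same space are isomorphic over it. -/
theorem IsCCCCVersion.exists_iso {Xh Xh' : MSN.{u}} {p : Xh ⟶ X} {p' : Xh' ⟶ X}
    (h : IsCCCCVersion p) (h' : IsCCCCVersion p') :
    ∃ (f : Xh ⟶ Xh') (g : Xh' ⟶ Xh), f ≫ g = 𝟙 _ ∧ g ≫ f = 𝟙 _ ∧ p = f ≫ p' ∧ p' = g ≫ p := by
  obtain ⟨f, hf, -⟩ := h'.existsUnique_lift Xh h.isCCCC p
  obtain ⟨g, hg, -⟩ := h.existsUnique_lift Xh' h'.isCCCC p'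
  refine ⟨f, g, ?_, ?_, hf, hg⟩
  -- Both f ≫ g and the identity lift p through itself.
  · exact (h.existsUnique_lift Xh h.isCCCC p).unique (by rw [Category.assoc, ← hg, ← hf])
      (Category.id_comp p).symm
  · exact (h'.existsUnique_lift Xh' h'.isCCCC p').unique (by rw [Category.assoc, ← hf, ← hg])
      (Category.id_comp p').symm

end Iso

/-! ### The measure on a disjoint union of traces -/

section SplitMeasure

variable {X : Type u} [MeasurableSpace X] (μ : Measure X) [μ.IsComplete]
  {I : Type u} {A : I → Set X}

/-- In a finite measure space only countably many almost disjoint sets have positive measure. -/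
theorem isCCC_trace_ofMeasure {A : Set X} (hA : MeasurableSet A) (hfin : μ A < ⊤) :
    ((MSN.ofMeasure μ).trace hA).IsCCC := by
  intro F hF hd
  have hF1 : ∀ E ∈ F, MeasurableSet (E ∩ A : Set X) := fun E hE => (hF E hE).1
  have : IsFiniteMeasure (μ.restrict A) := isFiniteMeasure_restrict.2 hfin.ne
  have h := Measure.countable_meas_pos_of_disjoint_iUnion₀ (μ := μ.restrict A)
    (As := fun E : F => (E.1 ∩ A : Set X)) (fun E => (hF1 E.1 E.2).nullMeasurableSet) (by
      intro E E' hne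
      have h0 : μ (E.1 ∩ E'.1 ∩ A : Set X) = 0 :=
        (hd E.1 E.2 E'.1 E'.2 fun h => hne (Subtype.ext h)).2
      refine measure_mono_null ?_ (le_zero_iff.1 ((Measure.restrict_le_self _).trans h0.le))
      exact fun x hx => ⟨⟨hx.1.1, hx.2.1⟩, hx.1.2⟩)
  have hu : {E : F | 0 < μ.restrict A (E.1 ∩ A : Set X)} = Set.univ := by
    refine Set.eq_univ_of_forall fun E => ?_
    refine (pos_iff_ne_zero.2 fun h0 => ?_ : 0 < μ.restrict A (E.1 ∩ A : Set X))
    rw [Measure.restrict_apply (hF1 E.1 E.2)] at h0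
    refine (hF E.1 E.2).2 ⟨hF1 E.1 E.2, measure_mono_null ?_ h0⟩
    exact fun x hx => ⟨hx, hx.2⟩
  rw [hu, Set.countable_univ_iff] at h
  exact h

/-- The measure on a disjoint union of traces whose restriction to each summand is the trace of
`μ`. -/
noncomputable def splitMeasure (hA : ∀ i, MeasurableSet (A i)) :
    Measure ((MSN.ofMeasure μ).split hA) :=
  Measure.ofMeasurable (fun E _ => ∑' i, μ (piece hA E i))
    (by
      have h : ∀ i, piece hA (∅ : Set ((MSN.ofMeasure μ).split hA)) i = ∅ := fun i => by
        ext x; exact ⟨fun h => h.1, fun h => h.elim⟩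
      simp [h])
    (by
      intro E hE hd
      rw [ENNReal.tsum_comm]
      refine tsum_congr fun i => ?_
      have h : piece hA (⋃ n, E n) i = ⋃ n, piece hA (E n) i := by
        ext x
        refine ⟨fun hx => ?_, fun hx => ?_⟩
        · obtain ⟨n, hn⟩ := Set.mem_iUnion.1 hx.1
          exact Set.mem_iUnion.2 ⟨n, hn, hx.2⟩
        · obtain ⟨n, hn⟩ := Set.mem_iUnion.1 hx
          exact ⟨Set.mem_iUnion.2 ⟨n, hn.1⟩, hn.2⟩
      rw [h]
      refine measure_iUnion ?_ fun n => measurableSet_split_iff.1 (hE n) i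
      intro m n hmn
      refine Set.disjoint_left.2 fun x hx hx' => ?_
      exact Set.disjoint_left.1 (hd hmn) hx.1 hx'.1)

variable {μ} {hA : ∀ i, MeasurableSet (A i)}

theorem splitMeasure_apply {E : Set ((MSN.ofMeasure μ).split hA)} (hE : MeasurableSet E) :
    splitMeasure μ hA E = ∑' i, μ (piece hA E i) :=
  Measure.ofMeasurable_apply E hE

theorem nullSets_splitMeasure :
    nullSets (splitMeasure μ hA) = ((MSN.ofMeasure μ).split hA).negligible := by
  ext E
  rw [negligible_split_iff]
  constructor
  · rintro ⟨hE, h0⟩ i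
    rw [splitMeasure_apply hE, ENNReal.tsum_eq_zero] at h0
    exact ⟨measurableSet_split_iff.1 hE i, h0 i⟩
  · intro h
    have hE : MeasurableSet E := measurableSet_split_iff.2 fun i => (h i).1
    refine ⟨hE, ?_⟩
    rw [splitMeasure_apply hE, ENNReal.tsum_eq_zero]
    exact fun i => (h i).2

/-- A measure on the disjoint union with the right null sets is the sum of its restrictions to the
summands. -/
theorem measure_split_eq_tsum {ν : Measure ((MSN.ofMeasure μ).split hA)}
    (hν : nullSets ν = ((MSN.ofMeasure μ).split hA).negligible)
    {E : Set ((MSN.ofMeasure μ).split hA)} (hE : MeasurableSet E) :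
    ν E = ∑' i, ν (E ∩ summand hA i) := by
  refine measure_eq_tsum_inter ν measurableSet_summand ?_ ?_ hE
  · intro i j hij
    convert measure_empty (μ := ν)
    ext x
    exact ⟨fun hx => hij (hx.1.symm.trans hx.2), fun hx => hx.elim⟩
  · intro C hC h
    refine measure_eq_zero hν (isEssSup_summand.mem_of_inter_mem hC ?_)
    rintro _ ⟨i, rfl⟩
    rw [← hν]
    exact ⟨(measurableSet_summand i).inter hC, h i⟩

theorem piece_inter_summand (E : Set ((MSN.ofMeasure μ).split hA)) (i : I) :
    piece hA (E ∩ summand hA i) i = piece hA E i := by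
  ext x
  exact ⟨fun h => ⟨h.1.1, h.2⟩, fun h => ⟨⟨h.1, rfl⟩, h.2⟩⟩

theorem piece_inter_summand_of_ne (E : Set ((MSN.ofMeasure μ).split hA)) {i j : I} (h : j ≠ i) :
    piece hA (E ∩ summand hA i) j = ∅ := by
  ext x
  exact ⟨fun hx => h hx.1.2, fun hx => hx.elim⟩

theorem splitMeasure_inter_summand {E : Set ((MSN.ofMeasure μ).split hA)} (hE : MeasurableSet E)
    (i : I) : splitMeasure μ hA (E ∩ summand hA i) = μ (piece hA E i) := by
  rw [splitMeasure_apply (hE.inter (measurableSet_summand i)), tsum_eq_single i,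
    piece_inter_summand]
  intro j hj
  rw [piece_inter_summand_of_ne E hj, measure_empty]

theorem isDecomposable_splitMeasure (hfin : ∀ i, μ (A i) < ⊤) :
    IsDecomposable (splitMeasure μ hA) := by
  refine ⟨I, summand hA, fun i => ⟨measurableSet_summand i, ?_⟩, ?_, ?_, ?_, fun E hE =>
    measure_split_eq_tsum nullSets_splitMeasure hE⟩
  · rw [← Set.univ_inter (summand hA i), splitMeasure_inter_summand MeasurableSet.univ]
    exact (measure_mono fun x hx => hx.2).trans_lt (hfin i)
  · exact fun i j hij => Set.disjoint_left.2 fun x hx hx' => hij (hx.symm.trans hx')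
  · exact Set.eq_univ_of_forall fun x => Set.mem_iUnion.2 ⟨x.1, rfl⟩
  · intro E hE
    refine measurableSet_split_iff.2 fun i => ?_
    rw [← piece_inter_summand]
    exact measurableSet_split_iff.1 (hE i) i

theorem map_splitMeasure (hd : ∀ i j, i ≠ j → μ (A i ∩ A j) = 0)
    (hmax : ∀ C, MeasurableSet C → (∀ i, μ (A i ∩ C) = 0) → μ C = 0) :
    Measure.map (splitMap hA : (MSN.ofMeasure μ).split hA → X) (splitMeasure μ hA) = μ := by
  refine Measure.ext fun B hB => ?_
  rw [Measure.map_apply (splitMap hA).measurable' hB,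
    splitMeasure_apply ((splitMap hA).measurable B hB), measure_eq_tsum_inter μ hA hd hmax hB]
  rfl

/-- The part of E in the i-th summand is almost everywhere the preimage of `piece hA E i`, so its
ν-measure is dictated by the image measure μ. -/
theorem eq_splitMeasure (hd : ∀ i j, i ≠ j → μ (A i ∩ A j) = 0)
    {ν : Measure ((MSN.ofMeasure μ).split hA)}
    (hν : nullSets ν = ((MSN.ofMeasure μ).split hA).negligible)
    (hmap : Measure.map (splitMap hA : (MSN.ofMeasure μ).split hA → X) ν = μ) :
    ν = splitMeasure μ hA := by
  refine Measure.ext fun E hE => ?_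
  rw [measure_split_eq_tsum hν hE, splitMeasure_apply hE]
  refine tsum_congr fun i => ?_
  have hm : MeasurableSet (piece hA E i) := measurableSet_split_iff.1 hE i
  have h1 : ν ((splitMap hA).toFun ⁻¹' piece hA E i) = μ (piece hA E i) := by
    rw [← Measure.map_apply (splitMap hA).measurable' hm, hmap]
  rw [← h1]
  refine measure_congr (Filter.eventuallyEq_set.2 (measure_eq_zero hν ?_))
  refine negligible_split_iff.2 fun j => ?_
  by_cases hji : j = i
  · subst hji
    convert (MSN.ofMeasure μ).empty_mem
    ext x
    refine ⟨fun hx => hx.1 ⟨fun h => ⟨h.1, hx.2⟩, fun h => ⟨h.1, rfl⟩⟩, fun hx => hx.elim⟩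
  -- In another summand j, the preimage of the i-th piece lies over A i ∩ A j, up to a negligible
  -- set.
  · refine (MSN.ofMeasure μ).saturated _ _ ?_ ⟨(hA i).inter (hA j), hd i j (Ne.symm hji)⟩
    rintro x ⟨hx, hxj⟩
    refine ⟨?_, hxj⟩
    by_contra hxi
    exact hx ⟨fun h => (hji h.2).elim, fun h => (hxi h.2).elim⟩

/-- Sets of finite measure in the disjoint union are almost everywhere equal to preimages. -/
theorem exists_preimage_splitMap (hd : ∀ i j, i ≠ j → μ (A i ∩ A j) = 0)
    {E : Set ((MSN.ofMeasure μ).split hA)} (hE : MeasurableSet E)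
    (hfin : splitMeasure μ hA E < ⊤) :
    ∃ B : Set X, MeasurableSet B ∧
      {x | ¬ (x ∈ E ↔ splitMap hA x ∈ B)} ∈ ((MSN.ofMeasure μ).split hA).negligible := by
  rw [splitMeasure_apply hE] at hfin
  have hJ := Summable.countable_support_ennreal hfin.ne
  set J := Function.support fun i => μ (piece hA E i)
  have hm : ∀ i, MeasurableSet (piece hA E i) := fun i => measurableSet_split_iff.1 hE i
  refine ⟨⋃ i ∈ J, piece hA E i, MeasurableSet.biUnion hJ fun i _ => hm i, ?_⟩
  refine negligible_split_iff.2 fun i => ?_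
  -- The union of pieces can be wrong in summand i only over the countably many overlaps of A i with
  -- the other A j, and, if i ∉ J, on the null piece of E.
  have hN1 : (⋃ j ∈ J \ {i}, A j ∩ A i) ∈ (MSN.ofMeasure μ).negligible :=
    (MSN.ofMeasure μ).biUnion_mem (hJ.mono Set.sdiff_subset) fun j hj =>
      ⟨(hA j).inter (hA i), hd j i hj.2⟩
  by_cases hi : i ∈ J
  · refine (MSN.ofMeasure μ).saturated _ _ ?_ hN1
    rintro x ⟨hx, hxi⟩
    by_contra hcon
    refine hx ⟨fun h => Set.mem_biUnion hi ⟨h, hxi⟩, fun h => ?_⟩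
    obtain ⟨j, hj, hxj⟩ := Set.mem_iUnion₂.1 h
    by_cases hji : j = i
    · subst hji; exact hxj.1
    · exact (hcon (Set.mem_biUnion (⟨hj, hji⟩ : j ∈ J \ {i}) ⟨hxj.2, hxi⟩)).elim
  · refine (MSN.ofMeasure μ).saturated _ _ ?_ ((MSN.ofMeasure μ).union_mem hN1
      ⟨hm i, Function.notMem_support.1 hi⟩)
    rintro x ⟨hx, hxi⟩
    by_contra hcon
    refine hx ⟨fun h => (hcon (Or.inr ⟨h, hxi⟩)).elim, fun h => ?_⟩
    obtain ⟨j, hj, hxj⟩ := Set.mem_iUnion₂.1 h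
    by_cases hji : j = i
    · subst hji; exact hxj.1
    · exact (hcon (Or.inl (Set.mem_biUnion (⟨hj, hji⟩ : j ∈ J \ {i}) ⟨hxj.2, hxi⟩))).elim

end SplitMeasure
end MSN

/-! ### The main theorem -/

theorem mainTheorem3 {X : Type u} [MeasurableSpace X] (μ : Measure X) [μ.IsComplete]
    (hμ : IsSemifinite μ) :
    (∃ (Xh : MSN.{u}) (P : Xh ⟶ MSN.ofMeasure μ), MSN.IsCCCCVersion P) ∧
    ∀ (Xh : MSN.{u}) (P : Xh ⟶ MSN.ofMeasure μ), MSN.IsCCCCVersion P →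
      ∃ μh : Measure Xh,
        nullSets μh = Xh.negligible ∧
        (∀ p : MSN.SPMap Xh (MSN.ofMeasure μ), p.toHom = P → Measure.map p μh = μ) ∧
        (∀ p : MSN.SPMap Xh (MSN.ofMeasure μ), p.toHom = P →
          ∀ ν : Measure Xh, Measure.map p ν = μ → nullSets ν = Xh.negligible → ν = μh) ∧
        IsDecomposable μh ∧
        Nonempty (Lp ℝ 1 μ ≃ₗᵢ[ℝ] Lp ℝ 1 μh) := by
  obtain ⟨F, hne, hF, hFd, hFmax⟩ := hμ.exists_maximal_family
  let A : F → Set X := Subtype.val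
  have : Nonempty F := hne.to_subtype
  have hA : ∀ i, MeasurableSet (A i) := fun i => (hF i.1 i.2).1
  have hd : ∀ i j, i ≠ j → μ (A i ∩ A j) = 0 := fun i j hij =>
    hFd i.1 i.2 j.1 j.2 fun h => hij (Subtype.ext h)
  have hmax : ∀ C, MeasurableSet C → (∀ i, μ (A i ∩ C) = 0) → μ C = 0 := fun C hC h =>
    hFmax C hC fun B hB => h ⟨B, hB⟩
  have hs : (MSN.ofMeasure μ).IsEssSup (Set.range A) Set.univ := by
    refine ⟨MeasurableSet.univ, fun E _ => by simp [nullSets], fun B hB h => ?_⟩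
    -- The complement of an upper bound B meets every A i in a null set, so maximality makes it
    -- null.
    rw [← Set.compl_eq_univ_sdiff]
    refine ⟨hB.compl, hmax _ hB.compl fun i => ?_⟩
    rw [← Set.sdiff_eq]
    exact (h _ ⟨i, rfl⟩).2
  have hv : MSN.IsCCCCVersion (MSN.splitMap (X := MSN.ofMeasure μ) hA).toHom :=
    MSN.isCCCCVersion_split hA (fun i j hij => ⟨(hA i).inter (hA j), hd i j hij⟩) hs
      fun i => MSN.isCCC_trace_ofMeasure μ (hA i) (hF i.1 i.2).2
  refine ⟨⟨_, _, hv⟩, fun Xh P hP => ?_⟩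
  obtain ⟨f, g, hfg, hgf, hPf, hPg⟩ := hP.exists_iso hv
  obtain ⟨f, rfl⟩ := MSN.exists_toHom_eq f
  obtain ⟨g, rfl⟩ := MSN.exists_toHom_eq g
  have hgf' := MSN.SPMap.toHom_eq_iff.1 hfg
  have hfg' := MSN.SPMap.toHom_eq_iff.1 hgf
  have h0 := MSN.nullSets_splitMeasure (μ := μ) (hA := hA)
  have hnull := MSN.nullSets_map g f hgf' h0
  have hmap : ∀ p : MSN.SPMap Xh (MSN.ofMeasure μ), p.toHom = P →
      Measure.map p (Measure.map g (MSN.splitMeasure μ hA)) = μ := by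
    rintro p rfl
    rw [Measure.map_map p.measurable' g.measurable']
    exact (MSN.map_congr h0 (MSN.SPMap.toHom_eq_iff.1 hPg)).symm.trans
      (MSN.map_splitMeasure (hA := hA) hd hmax)
  refine ⟨Measure.map g (MSN.splitMeasure μ hA), hnull, hmap, ?_,
    MSN.isDecomposable_map g f hgf' hfg' h0
      (MSN.isDecomposable_splitMeasure fun i => (hF i.1 i.2).2), ?_⟩
  · rintro p rfl ν hν hνnull
    -- Uniqueness is known on the disjoint union: push ν there by f, then return by g.
    have h1 : Measure.map f ν = MSN.splitMeasure μ hA := by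
      refine MSN.eq_splitMeasure hd (MSN.nullSets_map f g hfg' hνnull) ?_
      rw [Measure.map_map (MSN.splitMap hA).measurable' f.measurable']
      exact (MSN.map_congr hνnull (MSN.SPMap.toHom_eq_iff.1 hPf)).symm.trans hν
    rw [← h1, Measure.map_map g.measurable' f.measurable']
    exact (Measure.map_id.symm.trans (MSN.map_congr hνnull hgf').symm)
  · obtain ⟨p, rfl⟩ := MSN.exists_toHom_eq P
    refine nonempty_Lp_equiv (f := p) ⟨p.measurable', hmap p rfl⟩ fun E hE hfin => ?_
    rw [Measure.map_apply g.measurable' hE] at hfin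
    obtain ⟨B, hB, hEB⟩ := MSN.exists_preimage_splitMap hd (g.measurable E hE) hfin
    refine ⟨B, hB, Filter.eventuallyEq_set.2 (MSN.measure_eq_zero hnull ?_)⟩
    refine Xh.mem_of_subset_off (Xh.union_mem hgf' (MSN.SPMap.toHom_eq_iff.1 hPf))
      (f.preimage_mem _ hEB) fun x hx hxE => ?_
    have hx1 : g (f x) = x := by
      by_contra h; exact hx (Or.inl h)
    have hx2 : p x = MSN.splitMap hA (f x) := by
      by_contra h; exact hx (Or.inr h)
    intro h
    apply hxE
    change g (f x) ∈ E ↔ _ at h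
    rw [hx1, ← hx2] at h
    exact h
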